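/- Let $n\ge 1$ be an integer. There is a constant $C>0$, depending only on $n$, with the following property. Let $f:\mathbb{R}^n\to\mathbb{R}$ be a radial, locally integrable function, $f(x)=f_0(|x|)$, such that $r\mapsto r^{\frac{n-1}{2}}f_0(r)$ is non-increasing on $(0,\infty)$ and tends to $0$ as $r\to\infty$. Then for every $\xi\in\mathbb{R}^n\setminus\{0\}$ the Fourier transform of $f$, given by $$\widehat f(|\xi|)=(2\pi)^{n/2}\,|\xi|^{1-n/2}\,\lim_{N\to\infty}\int_0^N r^{n/2-1}f_0(r)\,J_{n/2-1}(|\xi|r)\,r\,dr,$$ where $J_\alpha$ is the Bessel function of the first kind of order $\alpha$, is well defined (the integrals over $(0,N]$ converge absolutely and the limit exists and is finite), and $$|\widehat f(|\xi|)|\le C\int_0^{1/|\xi|}r^{n-1}f_0(r)\,dr<\infty .$$ -/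

import Mathlib

open MeasureTheory Filter Topology Set

/-- The Bessel function of the first kind of real order `α`, at an argument `x > 0`:
`J_α(x) = ∑ₖ (-1)ᵏ / (k! Γ(k + α + 1)) (x / 2)^(2 k + α)`. -/
noncomputable def besselJ (α x : ℝ) : ℝ :=
  ∑' k : ℕ, (-1 : ℝ) ^ k / ((k.factorial : ℝ) * Real.Gamma ((k : ℝ) + α + 1)) *
    (x / 2) ^ (2 * (k : ℝ) + α)

/-- The integrand `r^(n/2 - 1) f₀(r) J_{n/2 - 1}(ρ r) r` of the Hankel formula for the Fourier
transform of the radial function `x ↦ f₀(|x|)` on `ℝⁿ` at frequencies of norm `ρ`. -/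
noncomputable def hankelIntegrand (n : ℕ) (f₀ : ℝ → ℝ) (ρ r : ℝ) : ℝ :=
  r ^ ((n : ℝ) / 2 - 1) * f₀ r * besselJ ((n : ℝ) / 2 - 1) (ρ * r) * r

/-- The Fourier transform of the radial function `x ↦ f₀(|x|)` on `ℝⁿ` exists at frequencies of
norm `ρ > 0` and equals `L`, in the sense of the Hankel formula
`(2π)^(n/2) ρ^(1 - n/2) ∫₀^∞ r^(n/2 - 1) f₀(r) J_{n/2 - 1}(ρ r) r dr`, where the integral is the
limit as `N → ∞` of the (Lebesgue) integrals over `(0, N]`. -/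
def HasRadialFourierTransformAt (n : ℕ) (f₀ : ℝ → ℝ) (ρ L : ℝ) : Prop :=
  (∀ N : ℝ, IntegrableOn (hankelIntegrand n f₀ ρ) (Ioc 0 N)) ∧
  Tendsto (fun N : ℝ => (2 * Real.pi) ^ ((n : ℝ) / 2) * ρ ^ (1 - (n : ℝ) / 2) *
    ∫ r in Ioc 0 N, hankelIntegrand n f₀ ρ r) atTop (𝓝 L)

/-!
Put `α = n / 2 - 1` and `g r = r^((n - 1) / 2) f₀ r`, which is antitone and, as it tends to `0`,
nonnegative. The Hankel integral at frequency `ρ` is split at `r = 1 / ρ`.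

Below `1 / ρ`, the integrand is `r^(n - 1) f₀ r` times `ρ^α` and a bounded factor, because
`x^(-α) J_α(x)` is an entire function of `x²` (`hankelIntegrand_eq_mul_besselSeries`). The function
`r^(n - 1) f₀ r` is integrable there by polar coordinates.

Above `1 / ρ`, the integrand is `ρ^(-1/2) g(r) u(ρ r)` with `u t = √t J_α(t)`. The integrals of `u`
over subintervals of `[1, ∞)` are uniformly bounded, and no asymptotic expansion of `J_α` is needed
for this: `u` solves `u'' = (c / t² - 1) u` with `c = α² - 1/4`, an energy estimate shows that `u`
and `u'` are bounded, and integrating `u = c u / t² - u''` gives the claim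
(`exists_abs_integral_le_of_perturbed_oscillator`). By the second mean value estimate
(`AntitoneOn.abs_integral_mul_le`), the integral over any `(x, y]` with `x ≥ 1 / ρ` is then
`O(ρ^(-3/2) g x)`. Letting `x → ∞` yields convergence; taking `x = 1 / ρ` bounds the tail by
`ρ^(-3/2) g (1 / ρ)`, and monotonicity of `g` bounds this by a multiple of
`ρ^α ∫_0^(1/ρ) r^(n - 1) f₀ r dr` (`mul_le_integral_Ioc_pow_mul`).
-/

/-! ### A second mean value estimate -/

/-- The estimate behind Bonnet's second mean value theorem: against a nonnegative antitone weight `g`,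
an integral is at most `g a` times the largest absolute value of the partial integrals. The weight
is written as the superposition of the indicators of its superlevel sets `{t | s < g t}`,
`0 < s ≤ g a`; each of these is an initial segment of `(a, b]`. -/
theorem AntitoneOn.abs_integral_mul_le {g h : ℝ → ℝ} {a b K : ℝ} (hab : a ≤ b)
    (hg : AntitoneOn g (Icc a b)) (hg0 : 0 ≤ g b) (hh : IntegrableOn h (Ioc a b))
    (hK : ∀ c ∈ Icc a b, |∫ t in a..c, h t| ≤ K) :
    |∫ t in Ioc a b, g t * h t| ≤ K * g a := by
  -- A globally antitone extension of `g` is measurable, which Fubini's theorem needs below.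
  obtain ⟨G, hG, hGg⟩ := hg.exists_antitone_extension
    ⟨g b, by rintro _ ⟨x, hx, rfl⟩; exact hg hx (right_mem_Icc.2 hab) hx.2⟩
    ⟨g a, by rintro _ ⟨x, hx, rfl⟩; exact hg (left_mem_Icc.2 hab) hx hx.1⟩
  have hGa : g a = G a := hGg (left_mem_Icc.2 hab)
  have hGb : g b = G b := hGg (right_mem_Icc.2 hab)
  set S : Set (ℝ × ℝ) := {p | p.2 < G p.1} with hS
  have hSm : MeasurableSet S := measurableSet_lt measurable_snd (hG.measurable.comp measurable_fst)
  set F : ℝ → ℝ → ℝ := fun t s => S.indicator (fun p => h p.1) (t, s) with hF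
  have hint : Integrable (Function.uncurry F)
      ((volume.restrict (Ioc a b)).prod (volume.restrict (Ioc 0 (G a)))) :=
    (Integrable.comp_fst (ν := volume.restrict (Ioc 0 (G a))) hh).indicator hSm
  have hlayer : ∀ t ∈ Ioc a b, g t * h t = ∫ s in Ioc 0 (G a), F t s := by
    intro t ht
    have ht' : t ∈ Icc a b := Ioc_subset_Icc_self ht
    have h0 : 0 ≤ G t := (hGb ▸ hg0).trans (hG ht.2)
    have : F t = (Iio (G t)).indicator (fun _ => h t) := by
      funext s; simp [hF, hS, Set.indicator]
    rw [this, setIntegral_indicator measurableSet_Iio, setIntegral_const, hGg ht']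
    have hset : Ioc 0 (G a) ∩ Iio (G t) = Ioo 0 (G t) := by
      ext s
      simp only [mem_inter_iff, mem_Ioc, mem_Iio, mem_Ioo]
      exact ⟨fun h => ⟨h.1.1, h.2⟩, fun h => ⟨⟨h.1, h.2.le.trans (hG ht.1.le)⟩, h.2⟩⟩
    rw [hset, Real.volume_real_Ioo_of_le h0, sub_zero, smul_eq_mul]
  have hinner : ∀ s, |∫ t in Ioc a b, F t s| ≤ K := by
    intro s
    set A : Set ℝ := Ioc a b ∩ {t | s < G t} with hA
    have hAm : MeasurableSet {t | s < G t} := measurableSet_lt measurable_const hG.measurable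
    have hFA : (fun t => F t s) = {t | s < G t}.indicator h := by
      funext t; simp [hF, hS, Set.indicator]
    have hbdd : BddAbove (insert a A) :=
      ⟨b, by rintro x (rfl | hx); exacts [hab, hx.1.2]⟩
    -- Inserting `a` makes the supremum meaningful, and equal to `a`, when `A` is empty.
    set c := sSup (insert a A) with hc
    have hac : a ≤ c := le_csSup hbdd (mem_insert _ _)
    have hcb : c ≤ b := csSup_le (insert_nonempty _ _)
      (by rintro x (rfl | hx); exacts [hab, hx.1.2])
    have hsub : A ⊆ Ioc a c := fun x hx => ⟨hx.1.1, le_csSup hbdd (mem_insert_of_mem _ hx)⟩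
    have hsup : Ioo a c ⊆ A := by
      intro x hx
      obtain ⟨y, hy, hxy⟩ := exists_lt_of_lt_csSup (insert_nonempty _ _) hx.2
      rcases hy with rfl | hy
      · exact absurd hx.1 hxy.not_gt
      · exact ⟨⟨hx.1, hx.2.le.trans hcb⟩, lt_of_lt_of_le hy.2 (hG hxy.le)⟩
    have hae : A =ᵐ[volume] Ioc a c :=
      (LE.le.eventuallyLE hsub).antisymm
        (Ioo_ae_eq_Ioc.symm.le.trans (LE.le.eventuallyLE hsup))
    rw [hFA, setIntegral_indicator hAm, setIntegral_congr_set hae,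
      ← intervalIntegral.integral_of_le hac]
    exact hK c ⟨hac, hcb⟩
  rw [setIntegral_congr_fun measurableSet_Ioc hlayer, integral_integral_swap hint, hGa]
  have h0 : 0 ≤ G a := (hGb ▸ hg0).trans (hG hab)
  have := norm_setIntegral_le_of_norm_le_const (μ := volume) (s := Ioc 0 (G a))
    (f := fun s => ∫ t in Ioc a b, F t s) (C := K) (by simp) (fun s _ => hinner s)
  simpa [Real.volume_real_Ioc_of_le h0] using this

/-! ### Oscillation of solutions of `v'' = (c / t² - 1) v` -/

/-- A solution `v` of `v'' = (c / t² - 1) v` is bounded on `[1, ∞)` together with `w = v'`: the energy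
`E = v² + w²` satisfies `E' = 2 c v w / t² ≤ |c| E / t²`, so that `E exp (|c| / t)` is antitone. -/
theorem exists_abs_le_of_perturbed_oscillator {v w : ℝ → ℝ} {c : ℝ}
    (hv : ∀ t, 0 < t → HasDerivAt v (w t) t)
    (hw : ∀ t, 0 < t → HasDerivAt w ((c / t ^ 2 - 1) * v t) t) :
    ∃ M, ∀ t, 1 ≤ t → |v t| ≤ M ∧ |w t| ≤ M := by
  set φ : ℝ → ℝ := fun t => (v t ^ 2 + w t ^ 2) * Real.exp (|c| / t) with hφ
  have hd : ∀ t, 0 < t → HasDerivAt φ ((2 * c * v t * w t - |c| * (v t ^ 2 + w t ^ 2)) / t ^ 2 *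
      Real.exp (|c| / t)) t := by
    intro t ht
    have he : HasDerivAt (fun t : ℝ => Real.exp (|c| / t))
        (Real.exp (|c| / t) * (|c| * (-(t ^ 2)⁻¹))) t := by
      simpa only [div_eq_mul_inv] using ((hasDerivAt_inv ht.ne').const_mul |c|).exp
    have := (((hv t ht).pow 2).add ((hw t ht).pow 2)).mul he
    refine this.congr_deriv ?_
    simp only [Pi.add_apply, Pi.pow_apply]
    field_simp
    ring
  have hanti : AntitoneOn φ (Ici 1) := by
    refine antitoneOn_of_deriv_nonpos (convex_Ici 1)
      (fun t ht => (hd t (zero_lt_one.trans_le ht)).continuousAt.continuousWithinAt)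
      (fun t ht => ?_) (fun t ht => ?_)
    all_goals
      rw [interior_Ici, mem_Ioi] at ht
      have ht0 := zero_lt_one.trans ht
    · exact (hd t ht0).differentiableAt.differentiableWithinAt
    · rw [(hd t ht0).deriv]
      refine mul_nonpos_of_nonpos_of_nonneg (div_nonpos_of_nonpos_of_nonneg ?_ (sq_nonneg t))
        (Real.exp_pos _).le
      have h1 : c * (v t * w t) ≤ |c| * |v t * w t| := (le_abs_self _).trans (abs_mul _ _).le
      have h2 : 2 * |v t * w t| ≤ v t ^ 2 + w t ^ 2 := by
        rw [abs_mul, ← sq_abs (v t), ← sq_abs (w t)]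
        nlinarith [sq_nonneg (|v t| - |w t|)]
      nlinarith [mul_le_mul_of_nonneg_left h2 (abs_nonneg c)]
  have hE : ∀ t, 1 ≤ t → v t ^ 2 + w t ^ 2 ≤ φ 1 := fun t ht => by
    refine le_trans ?_ (hanti self_mem_Ici ht ht)
    exact le_mul_of_one_le_right (by positivity) (Real.one_le_exp (by positivity))
  refine ⟨√(φ 1), fun t ht => ⟨Real.abs_le_sqrt ?_, Real.abs_le_sqrt ?_⟩⟩
  · exact (le_add_of_nonneg_right (sq_nonneg _)).trans (hE t ht)
  · exact (le_add_of_nonneg_left (sq_nonneg _)).trans (hE t ht)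

/-- The integrals of a solution of `v'' = (c / t² - 1) v` over subintervals of `[1, ∞)` are uniformly
bounded: since `v = c v / t² - v''`, they are boundary values of `-v'` plus integrals of the
absolutely integrable function `c v / t²`. -/
theorem exists_abs_integral_le_of_perturbed_oscillator {v w : ℝ → ℝ} {c : ℝ}
    (hv : ∀ t, 0 < t → HasDerivAt v (w t) t)
    (hw : ∀ t, 0 < t → HasDerivAt w ((c / t ^ 2 - 1) * v t) t) :
    ∃ B, 0 ≤ B ∧ ∀ x y, 1 ≤ x → x ≤ y → |∫ t in x..y, v t| ≤ B := by
  obtain ⟨M, hM⟩ := exists_abs_le_of_perturbed_oscillator hv hw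
  have hM0 : 0 ≤ M := (abs_nonneg _).trans (hM 1 le_rfl).1
  refine ⟨2 * M + |c| * M, by positivity, fun x y hx hxy => ?_⟩
  have hx0 : 0 < x := zero_lt_one.trans_le hx
  have hy0 : 0 < y := hx0.trans_le hxy
  have hpos : ∀ t ∈ uIcc x y, 0 < t := fun t ht => by
    rw [uIcc_of_le hxy] at ht; exact hx0.trans_le ht.1
  have hvc : ContinuousOn v (uIcc x y) := fun t ht =>
    (hv t (hpos t ht)).continuousAt.continuousWithinAt
  have hqc : ContinuousOn (fun t => c / t ^ 2 * v t) (uIcc x y) :=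
    (continuousOn_const.div (continuousOn_pow 2) fun t ht => (pow_pos (hpos t ht) 2).ne').mul hvc
  have hic : ContinuousOn (fun t : ℝ => (t ^ 2)⁻¹) (uIcc x y) :=
    (continuousOn_pow 2).inv₀ fun t ht => (pow_pos (hpos t ht) 2).ne'
  have h1 : (∫ t in x..y, (c / t ^ 2 * v t - v t)) = w y - w x :=
    intervalIntegral.integral_eq_sub_of_hasDerivAt
      (fun t ht => (hw t (hpos t ht)).congr_deriv (by ring))
      (hqc.sub hvc).intervalIntegrable
  rw [intervalIntegral.integral_sub hqc.intervalIntegrable hvc.intervalIntegrable] at h1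
  have h2 : (∫ t in x..y, |c| * M * (t ^ 2)⁻¹) = |c| * M * (-y⁻¹ - -x⁻¹) := by
    rw [intervalIntegral.integral_const_mul]
    congr 1
    exact intervalIntegral.integral_eq_sub_of_hasDerivAt (f := fun t => -t⁻¹)
      (fun t ht => (hasDerivAt_inv (hpos t ht).ne').neg.congr_deriv (by ring))
      hic.intervalIntegrable
  have h3 : ‖∫ t in x..y, c / t ^ 2 * v t‖ ≤ ∫ t in x..y, |c| * M * (t ^ 2)⁻¹ := by
    refine intervalIntegral.norm_integral_le_of_norm_le hxy (ae_of_all _ fun t ht => ?_)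
      (hic.intervalIntegrable.const_mul _)
    have ht1 : 1 ≤ t := hx.trans ht.1.le
    rw [Real.norm_eq_abs, abs_mul, abs_div, abs_of_pos (pow_pos (zero_lt_one.trans_le ht1) 2),
      div_eq_mul_inv, mul_right_comm]
    gcongr
    exact (hM t ht1).1
  have h4 : |c| * M * (-y⁻¹ - -x⁻¹) ≤ |c| * M := by
    refine mul_le_of_le_one_right (by positivity) ?_
    have : x⁻¹ ≤ 1 := inv_le_one_of_one_le₀ hx
    have : 0 < y⁻¹ := inv_pos.2 hy0
    linarith
  rw [h2, Real.norm_eq_abs] at h3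
  have h5 := abs_le.1 (h3.trans h4)
  have h6 := abs_le.1 (hM x hx).2
  have h7 := abs_le.1 (hM y (hx.trans hxy)).2
  exact abs_le.2 ⟨by linarith, by linarith⟩

/-! ### The Bessel function and its differential equation -/

/-- The coefficient `(-1)ᵏ / (k! Γ(k + s))` of the entire function `besselSeries s`. -/
noncomputable def besselSeriesCoeff (s : ℝ) (k : ℕ) : ℝ :=
  (-1) ^ k / ((k.factorial : ℝ) * Real.Gamma ((k : ℝ) + s))

/-- The entire function `∑ₖ (-1)ᵏ yᵏ / (k! Γ(k + s))`, for which
`J_α(x) = (x / 2)^α besselSeries (α + 1) (x² / 4)`. The parameter is `s = α + 1`, so that the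
assumption `α ≥ -1/2` reads `s ≥ 1/2`. -/
noncomputable def besselSeries (s y : ℝ) : ℝ := ∑' k : ℕ, besselSeriesCoeff s k * y ^ k

/-- A crude lower bound, enough for dominating the Bessel series by the exponential series. The factor
`1/2` accounts for the single step `Γ(1 + s) = s Γ(s)`, the only one whose factor may be below `1`. -/
theorem half_Gamma_le_Gamma_natCast_add {s : ℝ} (hs : 1 / 2 ≤ s) (k : ℕ) :
    Real.Gamma s / 2 ≤ Real.Gamma (k + s) := by
  have hs0 : 0 < s := by linarith
  have hG := Real.Gamma_pos_of_pos hs0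
  cases k with
  | zero => simp only [Nat.cast_zero, zero_add]; linarith
  | succ k =>
    induction k with
    | zero =>
      have := Real.Gamma_add_one hs0.ne'
      rw [zero_add, Nat.cast_one, add_comm, this]
      nlinarith
    | succ k ih =>
      push_cast at ih ⊢
      rw [show (k : ℝ) + 1 + 1 + s = (k + 1 + s) + 1 by ring,
        Real.Gamma_add_one (by positivity)]
      refine ih.trans (le_mul_of_one_le_left ?_ ?_)
      · exact (Real.Gamma_pos_of_pos (by positivity)).le
      · have : (0 : ℝ) ≤ k := k.cast_nonneg
        linarith

theorem abs_besselSeriesCoeff_le {s : ℝ} (hs : 1 / 2 ≤ s) (k : ℕ) :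
    |besselSeriesCoeff s k| ≤ 2 / Real.Gamma s * (1 / k.factorial) := by
  have hG := Real.Gamma_pos_of_pos (show 0 < s by linarith)
  have h := half_Gamma_le_Gamma_natCast_add hs k
  have h' : 0 < Real.Gamma (k + s) := lt_of_lt_of_le (by positivity) h
  rw [besselSeriesCoeff, abs_div, abs_pow, abs_neg, abs_one, one_pow, abs_of_pos (by positivity),
    div_mul_div_comm, mul_one, div_le_div_iff₀ (by positivity) (by positivity)]
  have : (0 : ℝ) < k.factorial := by positivity
  nlinarith

theorem summable_besselSeries {s : ℝ} (hs : 1 / 2 ≤ s) (y : ℝ) :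
    Summable fun k : ℕ => besselSeriesCoeff s k * y ^ k := by
  refine Summable.of_norm_bounded
    (((Real.summable_pow_div_factorial |y|).mul_left (2 / Real.Gamma s))) fun k => ?_
  rw [norm_mul, norm_pow, Real.norm_eq_abs, Real.norm_eq_abs]
  refine (mul_le_mul_of_nonneg_right (abs_besselSeriesCoeff_le hs k) (by positivity)).trans
    (le_of_eq (by ring))

/-- Coefficient form of the identity `besselSeries s' = -besselSeries (s + 1)`. -/
theorem succ_mul_besselSeriesCoeff_succ (s : ℝ) (k : ℕ) :
    (k + 1 : ℝ) * besselSeriesCoeff s (k + 1) = -besselSeriesCoeff (s + 1) k := by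
  have h1 : (k.factorial : ℝ) ≠ 0 := by positivity
  have h2 : (k : ℝ) + 1 ≠ 0 := by positivity
  simp only [besselSeriesCoeff, Nat.factorial_succ, Nat.cast_mul, Nat.cast_succ, pow_succ]
  rw [show (k : ℝ) + 1 + s = k + (s + 1) by ring, mul_assoc, ← div_div, mul_div_assoc',
    mul_div_assoc', mul_div_cancel_left₀ _ h2]
  ring

theorem hasDerivAt_besselSeries {s : ℝ} (hs : 1 / 2 ≤ s) (y : ℝ) :
    HasDerivAt (besselSeries s) (-besselSeries (s + 1) y) y := by
  set R := |y| + 1 with hR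
  have hR0 : 0 < R := by positivity
  have hmem : ∀ z ∈ Metric.ball (0 : ℝ) R, |z| ≤ R := fun z hz => by
    simpa using (Metric.mem_ball.1 hz).le
  have hu : Summable fun k : ℕ => 2 / Real.Gamma s * ((k : ℝ) * R ^ (k - 1) / k.factorial) := by
    refine Summable.mul_left _ ((summable_nat_add_iff 1).1 ?_)
    refine (Real.summable_pow_div_factorial R).congr fun k => ?_
    have h1 : (k.factorial : ℝ) ≠ 0 := by positivity
    have h2 : (k : ℝ) + 1 ≠ 0 := by positivity
    simp only [Nat.factorial_succ, Nat.cast_mul, Nat.cast_succ, Nat.add_sub_cancel]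
    rw [mul_div_mul_left _ _ h2]
  have hd := hasDerivAt_tsum_of_isPreconnected (g := fun k z => besselSeriesCoeff s k * z ^ k)
    (g' := fun k z => besselSeriesCoeff s k * (k * z ^ (k - 1))) hu Metric.isOpen_ball
    (convex_ball (0 : ℝ) R).isPreconnected
    (fun k z _ => (hasDerivAt_pow k z).const_mul _)
    (fun k z hz => by
      rw [norm_mul, norm_mul, norm_pow, Real.norm_eq_abs, Real.norm_eq_abs, Real.norm_eq_abs,
        abs_of_nonneg (Nat.cast_nonneg k : (0 : ℝ) ≤ k)]
      calc _ ≤ 2 / Real.Gamma s * (1 / k.factorial) * (k * R ^ (k - 1)) := by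
            have := Real.Gamma_pos_of_pos (show 0 < s by linarith)
            refine mul_le_mul (abs_besselSeriesCoeff_le hs k) ?_ (by positivity) (by positivity)
            have := hmem z hz
            gcongr
        _ = _ := by ring)
    (Metric.mem_ball_self hR0) (summable_besselSeries hs 0)
    (y := y) (by simp [hR])
  refine hd.congr_deriv ?_
  have hs' : Summable fun k : ℕ => besselSeriesCoeff s k * (k * y ^ (k - 1)) := by
    refine (summable_nat_add_iff 1).1
      ((summable_besselSeries (by linarith : 1 / 2 ≤ s + 1) y).neg.congr fun k => ?_)
    have := succ_mul_besselSeriesCoeff_succ s k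
    simp only [Nat.cast_succ, Nat.add_sub_cancel]
    linear_combination -y ^ k * this
  rw [hs'.tsum_eq_zero_add, besselSeries, ← tsum_neg]
  simp only [Nat.cast_zero, zero_mul, mul_zero, zero_add]
  refine tsum_congr fun k => ?_
  have := succ_mul_besselSeriesCoeff_succ s k
  simp only [Nat.cast_succ, Nat.add_sub_cancel]
  linear_combination y ^ k * this

theorem continuous_besselSeries {s : ℝ} (hs : 1 / 2 ≤ s) : Continuous (besselSeries s) :=
  continuous_iff_continuousAt.2 fun y => (hasDerivAt_besselSeries hs y).continuousAt

/-- The three-term recurrence of the Bessel functions. As `besselSeries (s + 1)` and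
`besselSeries (s + 2)` are, up to sign, the first two derivatives of `besselSeries s`, this is also
Bessel's differential equation. -/
theorem besselSeries_recurrence {s : ℝ} (hs : 1 / 2 ≤ s) (y : ℝ) :
    y * besselSeries (s + 2) y = s * besselSeries (s + 1) y - besselSeries s y := by
  have h1 := summable_besselSeries (by linarith : 1 / 2 ≤ s + 1) y
  have h2 := summable_besselSeries hs y
  have h3 : Summable fun k : ℕ => s * (besselSeriesCoeff (s + 1) k * y ^ k) -
    besselSeriesCoeff s k * y ^ k := (h1.mul_left s).sub h2
  have key : ∀ k : ℕ, s * (besselSeriesCoeff (s + 1) k * y ^ k) - besselSeriesCoeff s k * y ^ k =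
      -(k * besselSeriesCoeff (s + 1) k * y ^ k) := by
    intro k
    have hk : 0 < (k : ℝ) + s := by
      have : (0 : ℝ) ≤ k := k.cast_nonneg
      linarith
    have hG := Real.Gamma_pos_of_pos hk
    have : (k + s) * besselSeriesCoeff (s + 1) k = besselSeriesCoeff s k := by
      rw [besselSeriesCoeff, besselSeriesCoeff, ← add_assoc, Real.Gamma_add_one hk.ne']
      field_simp
    linear_combination y ^ k * this
  -- The combined series on the right has vanishing constant term, hence is `y` times a series.
  rw [besselSeries, besselSeries, besselSeries, ← tsum_mul_left, ← tsum_mul_left,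
    ← (h1.mul_left s).tsum_sub h2, h3.tsum_eq_zero_add, key 0]
  simp only [Nat.cast_zero, zero_mul, neg_zero, zero_add]
  refine tsum_congr fun k => ?_
  have := succ_mul_besselSeriesCoeff_succ (s + 1) k
  rw [add_assoc s 1 1, one_add_one_eq_two] at this
  rw [key, Nat.cast_succ]
  linear_combination y ^ (k + 1) * this

theorem besselJ_eq {α x : ℝ} (hx : 0 < x) :
    besselJ α x = (x / 2) ^ α * besselSeries (α + 1) (x ^ 2 / 4) := by
  rw [besselJ, besselSeries, ← tsum_mul_left]
  refine tsum_congr fun k => ?_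
  rw [Real.rpow_add (by positivity), Real.rpow_mul (by positivity), Real.rpow_natCast,
    Real.rpow_two, besselSeriesCoeff, ← add_assoc]
  ring

/-- The integrals of `√t J_α(t)` over subintervals of `[1, ∞)` are uniformly bounded. Up to the factor
`2^(-α)`, this function is `t^(α + 1/2) besselSeries (α + 1) (t² / 4)`, which solves
`v'' = ((α² - 1/4) / t² - 1) v` on `(0, ∞)`. -/
theorem exists_abs_integral_sqrt_mul_besselJ_le {α : ℝ} (hα : -1 / 2 ≤ α) :
    ∃ B, 0 ≤ B ∧ ∀ x y, 1 ≤ x → x ≤ y → |∫ t in x..y, t ^ (1 / 2 : ℝ) * besselJ α t| ≤ B := by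
  set s := α + 1 with hs
  have hs2 : 1 / 2 ≤ s := by linarith
  set a := α + 1 / 2 with ha
  set F : ℝ → ℝ → ℝ := fun s t => besselSeries s (t ^ 2 / 4) with hF
  have hFd : ∀ s, 1 / 2 ≤ s → ∀ t, HasDerivAt (F s) (-F (s + 1) t * (t / 2)) t := fun s hs t => by
    have h := (hasDerivAt_pow 2 t).div_const 4
    refine ((hasDerivAt_besselSeries hs (t ^ 2 / 4)).comp t h).congr_deriv ?_
    simp only [hF]
    ring
  have hpow : ∀ b t : ℝ, 0 < t → HasDerivAt (fun t : ℝ => t ^ b) (b * t ^ (b - 1)) t :=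
    fun b t ht => Real.hasDerivAt_rpow_const (Or.inl ht.ne')
  have hv : ∀ t, 0 < t → HasDerivAt (fun t => t ^ a * F s t)
      (a * t ^ (a - 1) * F s t - t ^ (a + 1) / 2 * F (s + 1) t) t := fun t ht => by
    refine ((hpow a t ht).mul (hFd s hs2 t)).congr_deriv ?_
    rw [Real.rpow_add_one ht.ne']
    ring
  have hw : ∀ t, 0 < t → HasDerivAt
      (fun t => a * t ^ (a - 1) * F s t - t ^ (a + 1) / 2 * F (s + 1) t)
      ((a * (a - 1) / t ^ 2 - 1) * (t ^ a * F s t)) t := fun t ht => by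
    refine ((((hpow (a - 1) t ht).const_mul a).mul (hFd s hs2 t)).sub
      (((hpow (a + 1) t ht).div_const 2).mul (hFd (s + 1) (by linarith) t))).congr_deriv ?_
    have hrec : t ^ 2 / 4 * F (s + 1 + 1) t = s * F (s + 1) t - F s t := by
      rw [add_assoc, one_add_one_eq_two]
      exact besselSeries_recurrence hs2 (t ^ 2 / 4)
    have e1 : t ^ (a + 1) = t ^ a * t := Real.rpow_add_one ht.ne' a
    have e2 : t ^ (a - 1) = t ^ a / t := Real.rpow_sub_one ht.ne' a
    have e3 : t ^ (a - 1 - 1) = t ^ a / t / t := by rw [Real.rpow_sub_one ht.ne', e2]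
    have hsa : s = a + 1 / 2 := by rw [hs, ha]; ring
    have hp : F s t = (a + 1 / 2) * F (s + 1) t - t ^ 2 / 4 * F (s + 1 + 1) t := by
      rw [hrec, ← hsa]; ring
    rw [add_sub_cancel_right, e1, e2, e3, hp]
    generalize F (s + 1) t = q, F (s + 1 + 1) t = r
    field_simp
    ring
  obtain ⟨B, hB0, hB⟩ := exists_abs_integral_le_of_perturbed_oscillator hv hw
  refine ⟨(2 : ℝ)⁻¹ ^ α * B, by positivity, fun x y hx hxy => ?_⟩
  have : ∫ t in x..y, t ^ (1 / 2 : ℝ) * besselJ α t =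
      ∫ t in x..y, (2 : ℝ)⁻¹ ^ α * (t ^ a * F s t) := by
    refine intervalIntegral.integral_congr fun t ht => ?_
    rw [uIcc_of_le hxy] at ht
    have ht0 : 0 < t := zero_lt_one.trans_le (hx.trans ht.1)
    have h2 : (t / 2) ^ α = t ^ α * (2 : ℝ)⁻¹ ^ α := by
      rw [div_eq_mul_inv, Real.mul_rpow ht0.le (by norm_num)]
    have h3 : t ^ a = t ^ α * t ^ (1 / 2 : ℝ) := Real.rpow_add ht0 _ _
    have h4 : besselJ α t = (t / 2) ^ α * F s t := besselJ_eq ht0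
    simp only [h2, h3, h4]
    ring
  rw [this, intervalIntegral.integral_const_mul, abs_mul, abs_of_pos (by positivity)]
  exact mul_le_mul_of_nonneg_left (hB x y hx hxy) (by positivity)

/-! ### The Hankel integral of a radial function -/

/-- Integration in polar coordinates, applied to the radial function `f` cut off outside a ball. -/
theorem integrableOn_pow_mul_of_locallyIntegrable_radial {n : ℕ} (hn : 1 ≤ n)
    {f : EuclideanSpace ℝ (Fin n) → ℝ} {f₀ : ℝ → ℝ} (hf : ∀ x, f x = f₀ ‖x‖)
    (hloc : LocallyIntegrable f volume) (R : ℝ) :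
    IntegrableOn (fun r : ℝ => r ^ (n - 1) * f₀ r) (Ioc 0 R) := by
  have : Nonempty (Fin n) := ⟨⟨0, hn⟩⟩
  have hball := hloc.integrableOn_isCompact (isCompact_closedBall (0 : EuclideanSpace ℝ (Fin n)) R)
  rw [← integrable_indicator_iff Metric.isClosed_closedBall.measurableSet] at hball
  have heq : (Metric.closedBall (0 : EuclideanSpace ℝ (Fin n)) R).indicator f =
      fun x => (Iic R).indicator f₀ ‖x‖ := by
    funext x
    simp [Set.indicator, hf]
  rw [heq, integrable_fun_norm_addHaar volume (f := (Iic R).indicator f₀),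
    finrank_euclideanSpace_fin] at hball
  refine ((hball.mono_set Ioc_subset_Ioi_self).congr_fun (fun r hr => ?_) measurableSet_Ioc)
  simp [Set.indicator, hr.2]

theorem AntitoneOn.nonneg_of_tendsto_atTop_zero {g : ℝ → ℝ} {a : ℝ} (hg : AntitoneOn g (Ioi a))
    (h0 : Tendsto g atTop (𝓝 0)) {r : ℝ} (hr : a < r) : 0 ≤ g r :=
  le_of_tendsto h0 <| (eventually_ge_atTop r).mono fun _ hx => hg hr (hr.trans_le hx) hx

/-- The form of the integrand used near `0`: the density `r^(n - 1) f₀ r` of `f` in polar coordinates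
times a continuous function of `r`. -/
theorem hankelIntegrand_eq_mul_besselSeries {n : ℕ} (hn : 1 ≤ n) (f₀ : ℝ → ℝ) {ρ r : ℝ}
    (hρ : 0 < ρ) (hr : 0 < r) :
    hankelIntegrand n f₀ ρ r = (ρ / 2) ^ ((n : ℝ) / 2 - 1) *
      (r ^ (n - 1) * f₀ r * besselSeries ((n : ℝ) / 2) ((ρ * r) ^ 2 / 4)) := by
  have h1 : r ^ (n - 1) = r ^ ((n : ℝ) / 2 - 1) * r ^ ((n : ℝ) / 2 - 1) * r := by
    rw [← Real.rpow_add hr, ← Real.rpow_add_one hr.ne', ← Real.rpow_natCast, Nat.cast_sub hn]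
    congr 1
    push_cast
    ring
  rw [hankelIntegrand, besselJ_eq (mul_pos hρ hr), sub_add_cancel, h1, mul_div_right_comm,
    Real.mul_rpow (by positivity) hr.le]
  ring

/-- The form of the integrand used away from `0`: the monotone weight `r^((n - 1) / 2) f₀ r` times the
oscillating function `√t J_(n/2 - 1)(t)` at `t = ρ r`. -/
theorem hankelIntegrand_eq_mul_sqrt_mul_besselJ (n : ℕ) (f₀ : ℝ → ℝ) {ρ r : ℝ}
    (hρ : 0 < ρ) (hr : 0 < r) :
    hankelIntegrand n f₀ ρ r = ρ ^ (-(1 / 2) : ℝ) * ((r ^ (((n : ℝ) - 1) / 2) * f₀ r) *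
      ((ρ * r) ^ (1 / 2 : ℝ) * besselJ ((n : ℝ) / 2 - 1) (ρ * r))) := by
  have h1 : r ^ ((n : ℝ) / 2 - 1) * r = r ^ (((n : ℝ) - 1) / 2) * r ^ (1 / 2 : ℝ) := by
    rw [← Real.rpow_add_one hr.ne', ← Real.rpow_add hr]
    congr 1
    ring
  have h2 : ρ ^ (-(1 / 2) : ℝ) * ρ ^ (1 / 2 : ℝ) = 1 := by
    rw [← Real.rpow_add hρ]; simp
  rw [hankelIntegrand, Real.mul_rpow hρ.le hr.le]
  linear_combination (f₀ r * besselJ ((n : ℝ) / 2 - 1) (ρ * r)) * h1 -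
    (f₀ r * besselJ ((n : ℝ) / 2 - 1) (ρ * r) * r ^ (((n : ℝ) - 1) / 2) * r ^ (1 / 2 : ℝ)) * h2

theorem integrableOn_hankelIntegrand {n : ℕ} (hn : 1 ≤ n) {f₀ : ℝ → ℝ} {ρ N : ℝ} (hρ : 0 < ρ)
    (hf : IntegrableOn (fun r : ℝ => r ^ (n - 1) * f₀ r) (Ioc 0 N)) :
    IntegrableOn (hankelIntegrand n f₀ ρ) (Ioc 0 N) := by
  have hn' : (1 : ℝ) ≤ n := by exact_mod_cast hn
  have hc : Continuous fun r : ℝ => besselSeries ((n : ℝ) / 2) ((ρ * r) ^ 2 / 4) :=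
    (continuous_besselSeries (by linarith)).comp (by fun_prop)
  have h : IntegrableOn (fun r : ℝ => r ^ (n - 1) * f₀ r *
      besselSeries ((n : ℝ) / 2) ((ρ * r) ^ 2 / 4)) (Ioc 0 N) := by
    rw [← integrableOn_Icc_iff_integrableOn_Ioc] at hf ⊢
    exact hf.mul_continuousOn hc.continuousOn isCompact_Icc
  exact IntegrableOn.congr_fun (h.const_mul _)
    (fun r hr => (hankelIntegrand_eq_mul_besselSeries hn f₀ hρ hr.1).symm) measurableSet_Ioc

/-- The contribution of `r ≤ 1 / ρ`, where the argument of the Bessel function is at most `1`. -/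
theorem exists_abs_integral_Ioc_inv_hankelIntegrand_le {n : ℕ} (hn : 1 ≤ n) :
    ∃ M, 0 ≤ M ∧ ∀ (f₀ : ℝ → ℝ) (ρ : ℝ), 0 < ρ →
      IntegrableOn (fun r : ℝ => r ^ (n - 1) * f₀ r) (Ioc 0 ρ⁻¹) →
      (∀ r ∈ Ioc 0 ρ⁻¹, 0 ≤ f₀ r) →
      |∫ r in Ioc 0 ρ⁻¹, hankelIntegrand n f₀ ρ r| ≤
        M * ρ ^ ((n : ℝ) / 2 - 1) * ∫ r in Ioc 0 ρ⁻¹, r ^ (n - 1) * f₀ r := by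
  have hn' : (1 : ℝ) ≤ n := by exact_mod_cast hn
  obtain ⟨M, hM⟩ := isCompact_Icc.exists_bound_of_continuousOn (s := Icc (0 : ℝ) 1)
    (continuous_besselSeries (show 1 / 2 ≤ (n : ℝ) / 2 by linarith)).continuousOn
  have hM0 : 0 ≤ M := (norm_nonneg _).trans (hM 0 (by simp))
  refine ⟨(2 : ℝ)⁻¹ ^ ((n : ℝ) / 2 - 1) * M, by positivity, fun f₀ ρ hρ hf h0 => ?_⟩
  rw [← integral_const_mul, ← Real.norm_eq_abs]
  refine norm_integral_le_of_norm_le (hf.const_mul _) ?_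
  refine (ae_restrict_mem measurableSet_Ioc).mono fun r hr => ?_
  have hr0 := hr.1
  have hf0 := h0 r hr
  have hρr : ρ * r ≤ 1 := (mul_le_mul_of_nonneg_left hr.2 hρ.le).trans (mul_inv_cancel₀ hρ.ne').le
  have hB := hM ((ρ * r) ^ 2 / 4) ⟨by positivity, by nlinarith [mul_pos hρ hr0]⟩
  rw [hankelIntegrand_eq_mul_besselSeries hn f₀ hρ hr0, norm_mul, norm_mul,
    Real.norm_of_nonneg (by positivity), Real.norm_of_nonneg (by positivity), div_eq_mul_inv,
    Real.mul_rpow hρ.le (by norm_num)]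
  calc _ ≤ ρ ^ ((n : ℝ) / 2 - 1) * 2⁻¹ ^ ((n : ℝ) / 2 - 1) * (r ^ (n - 1) * f₀ r * M) := by
        gcongr
    _ = _ := by ring

/-- The contribution of `r > 1 / ρ`: the oscillation of `√t J_(n/2 - 1)(t)` bounds the integral over
`(x, y]` by the value of the monotone weight at `x`, uniformly in `y`. -/
theorem exists_abs_integral_Ioc_hankelIntegrand_le {n : ℕ} (hn : 1 ≤ n) :
    ∃ B, 0 ≤ B ∧ ∀ (f₀ : ℝ → ℝ) (ρ : ℝ), 0 < ρ →
      AntitoneOn (fun r : ℝ => r ^ (((n : ℝ) - 1) / 2) * f₀ r) (Ioi 0) →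
      Tendsto (fun r : ℝ => r ^ (((n : ℝ) - 1) / 2) * f₀ r) atTop (𝓝 0) →
      ∀ x y, ρ⁻¹ ≤ x → x ≤ y → |∫ r in Ioc x y, hankelIntegrand n f₀ ρ r| ≤
        B * ρ ^ (-(3 / 2) : ℝ) * (x ^ (((n : ℝ) - 1) / 2) * f₀ x) := by
  have hn' : (1 : ℝ) ≤ n := by exact_mod_cast hn
  have hα : -1 / 2 ≤ (n : ℝ) / 2 - 1 := by linarith
  obtain ⟨B, hB0, hB⟩ := exists_abs_integral_sqrt_mul_besselJ_le hα
  refine ⟨B, hB0, fun f₀ ρ hρ hanti hlim x y hx hxy => ?_⟩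
  have hx0 : 0 < x := (inv_pos.2 hρ).trans_le hx
  set g : ℝ → ℝ := fun r => r ^ (((n : ℝ) - 1) / 2) * f₀ r
  set u : ℝ → ℝ := fun t => t ^ (1 / 2 : ℝ) * besselJ ((n : ℝ) / 2 - 1) t with hu
  have huc : ContinuousOn u (Ioi 0) := by
    have hc : ContinuousOn (fun t : ℝ => t ^ (1 / 2 : ℝ) * ((t / 2) ^ ((n : ℝ) / 2 - 1) *
        besselSeries ((n : ℝ) / 2 - 1 + 1) (t ^ 2 / 4))) (Ioi 0) := by
      refine ContinuousOn.mul ?_ (ContinuousOn.mul ?_ ?_)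
      · exact continuousOn_id.rpow_const fun t ht => Or.inl (ne_of_gt ht)
      · exact (continuousOn_id.div_const 2).rpow_const
          fun t ht => Or.inl (div_pos ht two_pos).ne'
      · exact ((continuous_besselSeries (by linarith)).comp (by fun_prop)).continuousOn
    exact hc.congr fun t ht => by simp only [hu]; rw [besselJ_eq ht]
  have hint : IntegrableOn (fun r => u (ρ * r)) (Ioc x y) := by
    refine (ContinuousOn.integrableOn_Icc ?_).mono_set Ioc_subset_Icc_self
    exact huc.comp (by fun_prop) fun r hr => mul_pos hρ (hx0.trans_le hr.1)
  have hK : ∀ c ∈ Icc x y, |∫ r in x..c, u (ρ * r)| ≤ ρ⁻¹ * B := fun c hc => by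
    rw [intervalIntegral.integral_comp_mul_left _ hρ.ne', smul_eq_mul, abs_mul,
      abs_of_pos (inv_pos.2 hρ)]
    refine mul_le_mul_of_nonneg_left (hB _ _ ?_ ?_) (inv_pos.2 hρ).le
    · exact (mul_inv_cancel₀ hρ.ne').ge.trans (mul_le_mul_of_nonneg_left hx hρ.le)
    · exact mul_le_mul_of_nonneg_left hc.1 hρ.le
  have key := AntitoneOn.abs_integral_mul_le hxy
    (hanti.mono fun r hr => hx0.trans_le hr.1)
    (hanti.nonneg_of_tendsto_atTop_zero hlim (hx0.trans_le hxy)) hint hK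
  rw [setIntegral_congr_fun measurableSet_Ioc fun r hr =>
      hankelIntegrand_eq_mul_sqrt_mul_besselJ n f₀ hρ (hx0.trans hr.1),
    integral_const_mul, abs_mul, abs_of_pos (by positivity)]
  refine (mul_le_mul_of_nonneg_left key (by positivity)).trans (le_of_eq ?_)
  have h3 : ρ ^ (-(3 / 2) : ℝ) = ρ ^ (-(1 / 2) : ℝ) * ρ⁻¹ := by
    rw [← Real.rpow_neg_one, ← Real.rpow_add hρ]; norm_num
  rw [h3]
  ring

/-- The value of the antitone weight `r^((n - 1) / 2) f₀ r` at `R` is controlled by the mass of `f₀` on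
`(0, R]`, as `r^(n - 1) f₀ r = r^((n - 1) / 2) (r^((n - 1) / 2) f₀ r)`. -/
theorem mul_le_integral_Ioc_pow_mul {n : ℕ} (hn : 1 ≤ n) {f₀ : ℝ → ℝ} {R : ℝ} (hR : 0 < R)
    (hanti : AntitoneOn (fun r : ℝ => r ^ (((n : ℝ) - 1) / 2) * f₀ r) (Ioi 0))
    (hf : IntegrableOn (fun r : ℝ => r ^ (n - 1) * f₀ r) (Ioc 0 R)) :
    R ^ (((n : ℝ) - 1) / 2) * f₀ R * R ^ (((n : ℝ) + 1) / 2) ≤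
      ((n : ℝ) + 1) / 2 * ∫ r in Ioc 0 R, r ^ (n - 1) * f₀ r := by
  have hn' : (1 : ℝ) ≤ n := by exact_mod_cast hn
  have hexp : (-1 : ℝ) < ((n : ℝ) - 1) / 2 := by linarith
  set G := R ^ (((n : ℝ) - 1) / 2) * f₀ R with hG
  have h1 : ∫ r in Ioc 0 R, r ^ (((n : ℝ) - 1) / 2) * G =
      R ^ (((n : ℝ) + 1) / 2) / (((n : ℝ) + 1) / 2) * G := by
    rw [integral_mul_const, ← intervalIntegral.integral_of_le hR.le, integral_rpow (Or.inl hexp),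
      Real.zero_rpow (by linarith), sub_zero]
    congr 3 <;> ring
  have hi : IntegrableOn (fun r : ℝ => r ^ (((n : ℝ) - 1) / 2) * G) (Ioc 0 R) :=
    ((intervalIntegrable_iff_integrableOn_Ioc_of_le hR.le).1
      (intervalIntegral.intervalIntegrable_rpow' hexp)).mul_const G
  have h2 := setIntegral_mono_on hi hf measurableSet_Ioc fun r hr => by
    have hp : r ^ (n - 1) = r ^ (((n : ℝ) - 1) / 2) * r ^ (((n : ℝ) - 1) / 2) := by
      rw [← Real.rpow_add hr.1, ← Real.rpow_natCast, Nat.cast_sub hn]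
      congr 1
      push_cast
      ring
    rw [hp, mul_assoc]
    exact mul_le_mul_of_nonneg_left (hanti hr.1 hR hr.2) (Real.rpow_nonneg hr.1.le _)
  rw [h1] at h2
  have h3 : (0 : ℝ) < ((n : ℝ) + 1) / 2 := by positivity
  have h4 := mul_le_mul_of_nonneg_left h2 h3.le
  refine le_trans (le_of_eq ?_) h4
  field_simp

theorem mainTheorem2 (n : ℕ) (hn : 1 ≤ n) :
    ∃ C : ℝ, 0 < C ∧
      ∀ (f : EuclideanSpace ℝ (Fin n) → ℝ) (f₀ : ℝ → ℝ),
        (∀ x, f x = f₀ ‖x‖) →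
        LocallyIntegrable f volume →
        AntitoneOn (fun r : ℝ => r ^ (((n : ℝ) - 1) / 2) * f₀ r) (Ioi 0) →
        Tendsto (fun r : ℝ => r ^ (((n : ℝ) - 1) / 2) * f₀ r) atTop (𝓝 0) →
        ∀ ξ : EuclideanSpace ℝ (Fin n), ξ ≠ 0 →
          ∃ L : ℝ, HasRadialFourierTransformAt n f₀ ‖ξ‖ L ∧
            IntegrableOn (fun r : ℝ => r ^ (n - 1) * f₀ r) (Ioc 0 ‖ξ‖⁻¹) ∧
            |L| ≤ C * ∫ r in Ioc 0 ‖ξ‖⁻¹, r ^ (n - 1) * f₀ r := by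
  obtain ⟨M, hM0, hM⟩ := exists_abs_integral_Ioc_inv_hankelIntegrand_le hn
  obtain ⟨B, hB0, hB⟩ := exists_abs_integral_Ioc_hankelIntegrand_le hn
  -- `M` comes from the range `r ≤ 1 / ρ`, the other term from `r > 1 / ρ`; adding `1` only ensures
  -- positivity.
  refine ⟨(2 * Real.pi) ^ ((n : ℝ) / 2) * (M + B * (((n : ℝ) + 1) / 2)) + 1, by positivity,
    fun f f₀ hf hloc hanti hlim ξ hξ => ?_⟩
  have hρ : 0 < ‖ξ‖ := norm_pos_iff.2 hξ
  set ρ := ‖ξ‖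
  have hR : 0 < ρ⁻¹ := inv_pos.2 hρ
  have hint := integrableOn_pow_mul_of_locallyIntegrable_radial hn hf hloc
  have hH : ∀ N, IntegrableOn (hankelIntegrand n f₀ ρ) (Ioc 0 N) := fun N =>
    integrableOn_hankelIntegrand hn hρ (hint N)
  have hf0 : ∀ r, 0 < r → 0 ≤ f₀ r := fun r hr =>
    nonneg_of_mul_nonneg_right (hanti.nonneg_of_tendsto_atTop_zero hlim hr)
      (Real.rpow_pos_of_pos hr _)
  set I := ∫ r in Ioc 0 ρ⁻¹, r ^ (n - 1) * f₀ r with hI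
  have hI0 : 0 ≤ I := setIntegral_nonneg measurableSet_Ioc fun r hr =>
    mul_nonneg (pow_nonneg hr.1.le _) (hf0 r hr.1)
  set Φ : ℝ → ℝ := fun N => ∫ r in Ioc 0 N, hankelIntegrand n f₀ ρ r
  have hsplit : ∀ x y, 0 ≤ x → x ≤ y →
      Φ y - Φ x = ∫ r in Ioc x y, hankelIntegrand n f₀ ρ r := fun x y hx hxy => by
    rw [sub_eq_iff_eq_add', ← setIntegral_union (Ioc_disjoint_Ioc_of_le le_rfl) measurableSet_Ioc
      (hH x) ((hH y).mono_set (Ioc_subset_Ioc_left hx)), Ioc_union_Ioc_eq_Ioc hx hxy]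
  have htail : ∀ x y, ρ⁻¹ ≤ x → x ≤ y → |Φ y - Φ x| ≤
      B * ρ ^ (-(3 / 2) : ℝ) * (x ^ (((n : ℝ) - 1) / 2) * f₀ x) := fun x y hx hxy => by
    rw [hsplit x y (hR.le.trans hx) hxy]
    exact hB f₀ ρ hρ hanti hlim x y hx hxy
  have hcauchy : CauchySeq Φ := by
    rw [Metric.cauchySeq_iff']
    intro ε hε
    have hlim' := hlim.const_mul (B * ρ ^ (-(3 / 2) : ℝ))
    rw [mul_zero] at hlim'
    obtain ⟨x, hxε, hx⟩ := ((hlim'.eventually_lt_const hε).and (eventually_ge_atTop ρ⁻¹)).exists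
    exact ⟨x, fun y hy => (htail x y hx hy).trans_lt hxε⟩
  obtain ⟨L, hL⟩ := cauchySeq_tendsto_of_complete hcauchy
  refine ⟨_, ⟨hH, hL.const_mul _⟩, hint _, ?_⟩
  have hbound : |L| ≤ (M + B * (((n : ℝ) + 1) / 2)) * ρ ^ ((n : ℝ) / 2 - 1) * I := by
    refine le_of_tendsto hL.abs ((eventually_ge_atTop ρ⁻¹).mono fun N hN => ?_)
    have h1 := hM f₀ ρ hρ (hint _) fun r hr => hf0 r hr.1
    have h2 := htail ρ⁻¹ N le_rfl hN
    have h3 := mul_le_integral_Ioc_pow_mul hn hR hanti (hint _)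
    have h4 : ρ ^ (-(3 / 2) : ℝ) = ρ ^ ((n : ℝ) / 2 - 1) * ρ⁻¹ ^ (((n : ℝ) + 1) / 2) := by
      rw [Real.inv_rpow hρ.le, ← Real.rpow_neg hρ.le, ← Real.rpow_add hρ]
      congr 1
      ring
    have h5 : |Φ N| ≤ |Φ ρ⁻¹| + |Φ N - Φ ρ⁻¹| := by
      simpa using abs_add_le (Φ ρ⁻¹) (Φ N - Φ ρ⁻¹)
    calc |Φ N| ≤ M * ρ ^ ((n : ℝ) / 2 - 1) * I + B * ρ ^ ((n : ℝ) / 2 - 1) *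
          (ρ⁻¹ ^ (((n : ℝ) - 1) / 2) * f₀ ρ⁻¹ * ρ⁻¹ ^ (((n : ℝ) + 1) / 2)) := by
            refine h5.trans (add_le_add h1 (h2.trans (le_of_eq ?_)))
            rw [h4]
            ring
      _ ≤ M * ρ ^ ((n : ℝ) / 2 - 1) * I + B * ρ ^ ((n : ℝ) / 2 - 1) *
          (((n : ℝ) + 1) / 2 * I) := by gcongr
      _ = _ := by ring
  have hρ1 : ρ ^ (1 - (n : ℝ) / 2) * ρ ^ ((n : ℝ) / 2 - 1) = 1 := by
    rw [← Real.rpow_add hρ]; simp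
  rw [abs_mul, abs_of_pos (by positivity)]
  calc _ ≤ (2 * Real.pi) ^ ((n : ℝ) / 2) * ρ ^ (1 - (n : ℝ) / 2) *
        ((M + B * (((n : ℝ) + 1) / 2)) * ρ ^ ((n : ℝ) / 2 - 1) * I) := by gcongr
    _ = (2 * Real.pi) ^ ((n : ℝ) / 2) * (M + B * (((n : ℝ) + 1) / 2)) * I := by
        linear_combination
          ((2 * Real.pi) ^ ((n : ℝ) / 2) * (M + B * (((n : ℝ) + 1) / 2)) * I) * hρ1
    _ ≤ _ := by linarith
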